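/- **Setting.** Fix constants (not depending on $p$): a number of regions $S\ge 1$, a degree $d\ge 1$, coupling parameters $\theta_s>0$ with $d\bar\theta<1$ where $\bar\theta=\max_s\theta_s$, shape constants $\beta_s>4$, proportions $\nu_s>0$ ($s=1,\dots,S$), a vertex density $\eta>0$, a constant $\rho>0$ and $\xi\in(0,\tfrac12]$. Consider a sequence of domains with $p\to\infty$ vertices. Each domain $\mathcal F\subset\mathbb R^2$ is a connected union of cells of a square lattice of width $r=\rho A^{\xi}$, where $A$ is the area of $\mathcal F$. Its $p$ vertices have given positions and cover it uniformly with density $\eta$: every cell contains $\eta r^2(1+o(1))$ vertices, uniformly over the cells. The family of models consists of all pairs (partition, graph) such that: * $\mathcal F$ is partitioned into $S$ convex polyominoes $\mathcal F_1,\dots,\mathcal F_S$ of the lattice; $\mathcal F_s$ contains $\nu_s p$ of the vertices, and its area $A_s$ and boundary length $l_s$ satisfy $l_s=\beta_s A_s^{1/2}$ and $2A_s/l_s\ge r$ (the two equalities are meant up to given rounding errors of relative size $o(1)$); * the graph on the $p$ vertices is $d$-regular, and for every square contained in $\mathcal F$ that consists of $t\times t$ lattice cells, $t\ge1$, the number of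 edges that leave the set $A'$ of vertices in the square is $\ll d\sqrt{|A'|}$, i.e. at most $\varepsilon_p\, d\sqrt{|A'|}$ for a given sequence $\varepsilon_p\to0$. Assume that the families are nonempty. A model determines a precision matrix $\mathbf J$: $\mathbf J_{ii}=1$; if $i\neq j$ are adjacent, $i\in\mathcal F_s$, $j\in\mathcal F_t$, then $\mathbf J_{ij}=(\theta_s+\theta_t)/2$ (so $\theta_s$ inside $\mathcal F_s$); all other entries are $0$. A model is drawn uniformly from the family; $G_p$ denotes its graph. Given the model, $n=n_p$ i.i.d. samples are drawn from $N(0,\mathbf J^{-1})$; an arbitrary measurable procedure selects from them a graph $\widehat G_p$. Let $\mathbb P_e^G=\mathbb P[\widehat G_p\neq G_p]$, the probability being taken over the model and the samples. **Theorem.** If $\mathbb P_e^G\to0$, then, as soon as $p$ is large enough along the sequence, $$n\;\ge\;\frac{d\,\log\left(\frac{p^{\xi}}{d}\right)}{\log\left(\frac{(2\pi e)^2}{1-d\bar\theta}\right)}.$$ In particular $\log p=O(n)$: recovering every edge requires a number of samples that grows at least logarithmically in $p$. -/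

import Mathlib

open MeasureTheory ProbabilityTheory Filter Topology

noncomputable section

/-! ### Polyominoes on the square lattice

A lattice cell is identified with the integer coordinates of its lower left node. -/

/-- Two lattice cells are adjacent when they share a side. -/
def cellGraph : SimpleGraph (ℤ × ℤ) where
  Adj a b := |a.1 - b.1| + |a.2 - b.2| = 1
  symm := ⟨fun a b h => by rwa [abs_sub_comm b.1, abs_sub_comm b.2]⟩
  loopless := ⟨fun a h => by simp at h⟩

/-- A polyomino: a nonempty finite set of lattice cells that is connected through cell sides. -/
def IsPolyomino (P : Finset (ℤ × ℤ)) : Prop :=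
  (cellGraph.induce (P : Set (ℤ × ℤ))).Connected

/-- A convex polyomino: every row and every column of it is contiguous. -/
def IsConvexPolyomino (P : Finset (ℤ × ℤ)) : Prop :=
  IsPolyomino P ∧
  (∀ x₁ x₂ x₃ y : ℤ, x₁ ≤ x₂ → x₂ ≤ x₃ → (x₁, y) ∈ P → (x₃, y) ∈ P → (x₂, y) ∈ P) ∧
  (∀ x y₁ y₂ y₃ : ℤ, y₁ ≤ y₂ → y₂ ≤ y₃ → (x, y₁) ∈ P → (x, y₃) ∈ P → (x, y₂) ∈ P)

/-- The perimeter in lattice units: the number of cell sides with exactly one of the two incident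
cells in the polyomino. -/
def latticePerimeter (P : Finset (ℤ × ℤ)) : ℕ :=
  ∑ c ∈ P, (({(c.1 + 1, c.2), (c.1 - 1, c.2), (c.1, c.2 + 1), (c.1, c.2 - 1)} :
    Finset (ℤ × ℤ)).filter (· ∉ P)).card

/-- The `t × t` lattice square whose lower left cell is `a`. -/
def latticeSquare (a : ℤ × ℤ) (t : ℕ) : Finset (ℤ × ℤ) :=
  Finset.Ico a.1 (a.1 + t) ×ˢ Finset.Ico a.2 (a.2 + t)

/-! ### Model parameters and the domain carrying the vertices -/

/-- The constants of the model, which do not depend on the number of vertices: the number `S ≥ 1`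
of regions, the degree `d`, the coupling parameters `θ s`, the shape constants `β s`, the
proportions `ν s`, the vertex density `η`, and the constants `ρ`, `ξ` of the lattice width. -/
structure ModelParams (S : ℕ) where
  d : ℕ
  θ : Fin S → ℝ
  β : Fin S → ℝ
  ν : Fin S → ℝ
  η : ℝ
  ρ : ℝ
  ξ : ℝ
  S_pos : 0 < S
  d_pos : 0 < d
  θ_pos : ∀ s, 0 < θ s
  β_gt : ∀ s, 4 < β s
  ν_pos : ∀ s, 0 < ν s
  η_pos : 0 < η
  ρ_pos : 0 < ρ
  ξ_pos : 0 < ξ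
  ξ_le : ξ ≤ 1 / 2
  /-- correlation decay, `d * max θ < 1` -/
  corr_decay : ∀ s, d * θ s < 1

/-- The largest coupling parameter. -/
def ModelParams.θmax {S : ℕ} (M : ModelParams S) : ℝ := ⨆ s, M.θ s

/-- The cell, in the lattice of width `r`, that contains a point of the plane. -/
def cellOf (r : ℝ) (x : ℝ × ℝ) : ℤ × ℤ := (⌊x.1 / r⌋, ⌊x.2 / r⌋)

/-- A connected domain made of cells of the square lattice of width `r`, and the positions in it
of the `p` vertices. -/
structure Domain (p : ℕ) where
  r : ℝ
  r_pos : 0 < r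
  cells : Finset (ℤ × ℤ)
  isPolyomino : IsPolyomino cells
  pos : Fin p → ℝ × ℝ
  pos_mem : ∀ i, cellOf r (pos i) ∈ cells

namespace Domain

variable {p S : ℕ} (D : Domain p)

/-- The area of the domain. -/
def area : ℝ := D.cells.card * D.r ^ 2

/-- The cell of the domain in which vertex `i` lies. -/
def vertexCell (i : Fin p) : D.cells := ⟨cellOf D.r (D.pos i), D.pos_mem i⟩

/-- The vertices that lie in a given set of cells. -/
def verticesIn (H : Finset (ℤ × ℤ)) : Finset (Fin p) :=
  Finset.univ.filter fun i => (D.vertexCell i : ℤ × ℤ) ∈ H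

/-- The vertices cover the domain uniformly with areal density `η`, up to the relative error `γ`:
each lattice cell, whose area is `r ^ 2`, contains `η * r ^ 2` vertices up to that error. -/
def UniformDensity (η γ : ℝ) : Prop :=
  ∀ c ∈ D.cells, |((D.verticesIn {c}).card : ℝ) - η * D.r ^ 2| ≤ γ * (η * D.r ^ 2)

/-- The set of cells of the region with label `s`, when the cells of the domain are distributed
among `S` regions by `lab`. -/
def region (lab : D.cells → Fin S) (s : Fin S) : Finset (ℤ × ℤ) :=
  (Finset.univ.filter fun c => lab c = s).map (Function.Embedding.subtype _)

/-- The area of a region. -/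
def regionArea (lab : D.cells → Fin S) (s : Fin S) : ℝ := (D.region lab s).card * D.r ^ 2

/-- The length of the boundary of a region. -/
def regionLength (lab : D.cells → Fin S) (s : Fin S) : ℝ :=
  latticePerimeter (D.region lab s) * D.r

/-- Admissible partitions of the domain into `S` regions: the regions are convex polyominoes of
the lattice of width `r`, they contain the proportions `ν s` of the vertices, their boundary
lengths satisfy `l s = β s * √(A s)`, and `2 * A s / l s ≥ r`. The number `δ` is the tolerance
that stands for rounding to integers. -/
def IsAdmissiblePartition (M : ModelParams S) (δ : ℝ) (lab : D.cells → Fin S) : Prop :=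
  ∀ s, IsConvexPolyomino (D.region lab s) ∧
    |((D.verticesIn (D.region lab s)).card : ℝ) - M.ν s * p| ≤ δ * p ∧
    |D.regionLength lab s - M.β s * √(D.regionArea lab s)| ≤ δ * √(D.regionArea lab s) ∧
    D.r ≤ 2 * D.regionArea lab s / D.regionLength lab s

open Classical in
/-- Locality of connections: at most `ε * d * √|A|` edges leave the set `A` of vertices that lie
in a lattice square contained in the domain. -/
def IsLocal (d : ℕ) (ε : ℝ) (G : SimpleGraph (Fin p)) : Prop :=
  ∀ (a : ℤ × ℤ) (t : ℕ), 1 ≤ t → latticeSquare a t ⊆ D.cells →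
    (((D.verticesIn (latticeSquare a t) ×ˢ (D.verticesIn (latticeSquare a t))ᶜ).filter
      fun e => G.Adj e.1 e.2).card : ℝ) ≤ ε * d * √((D.verticesIn (latticeSquare a t)).card)

open Classical in
/-- The family of models: all pairs of an admissible partition into regions and of a `d`-regular
graph on the vertices with local connections. -/
def family (M : ModelParams S) (δ ε : ℝ) :
    Finset ((D.cells → Fin S) × SimpleGraph (Fin p)) :=
  Finset.univ.filter fun g =>
    D.IsAdmissiblePartition M δ g.1 ∧ g.2.IsRegularOfDegree M.d ∧ D.IsLocal M.d ε g.2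

open Classical in
/-- The precision matrix of a model: units on the diagonal, `θ s` on the edges inside region `s`,
the average `(θ s + θ t) / 2` on the edges between the regions `s` and `t`, zeros elsewhere. -/
def precision (M : ModelParams S) (g : (D.cells → Fin S) × SimpleGraph (Fin p)) :
    Matrix (Fin p) (Fin p) ℝ :=
  Matrix.of fun i j =>
    if i = j then 1
    else if g.2.Adj i j then
      (M.θ (g.1 (D.vertexCell i)) + M.θ (g.1 (D.vertexCell j))) / 2
    else 0

/-- The law of `n` independent snapshots of the centred Gaussian Markov field of a model. -/
def sampleLaw (M : ModelParams S) (g : (D.cells → Fin S) × SimpleGraph (Fin p)) (n : ℕ) :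
    Measure (Fin n → EuclideanSpace ℝ (Fin p)) :=
  Measure.pi fun _ => multivariateGaussian 0 (D.precision M g)⁻¹

/-- The probability that the graph selected by `ψ` from `n` snapshots differs from the true graph,
when the model is drawn uniformly from the family. -/
def errorProb (M : ModelParams S) (δ ε : ℝ) (n : ℕ)
    (ψ : (Fin n → EuclideanSpace ℝ (Fin p)) → SimpleGraph (Fin p)) : ℝ :=
  (∑ g ∈ D.family M δ ε, (D.sampleLaw M g n).real {x | ψ x ≠ g.2}) / (D.family M δ ε).card

end Domain

end

/-!
The lower bound holds because the graph can take very many values, whereas the laws of the samples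
are all dominated by one common law.

*Domination.* Let `x = d * θmax < 1`. A precision matrix `J` of the family has unit diagonal and
off-diagonal row sums at most `x`, so it is at least `1 - x` as a quadratic form
(`one_sub_mul_dotProduct_le`), and its determinant is at most `1`
(`Matrix.PosDef.det_le_one_of_diag`). Hence the density of `N(0, J⁻¹)` is at most `σ ^ p` times
the density of `N(0, σ ^ 2)`, where `σ ^ 2 = 1 / (1 - x)` (`multivariateGaussian_inv_le`), and for
`n` samples the factor is `σ ^ (p * n)`. The events that the procedure selects the graph `G` are
disjoint for different `G`, so the chance of success is at most `σ ^ (p * n)` divided by the number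
of graphs (`Domain.one_sub_errorProb_mul_card_le`). This replaces Fano's inequality and needs no
entropies.

*Counting.* The family contains some graph. Replacing two of its edges `ab`, `ce` inside one cell
by `ae`, `cb` keeps it regular, and it does not affect the locality condition, which concerns edges
between different cells only. Each such switching has of order `p ^ (2 * ξ)` outcomes, the
population of a cell. Almost all edges lie inside cells by locality, and so about `d * p / 4`
switchings can be carried out in succession. A final graph determines each step up to `d ^ 2`
possibilities, so there are about `p ^ (2 * ξ * d * p / 4)` graphs (`pow_le_card_rewirings`,
`eventually_pow_le_card_localGraphs`).

Taking logarithms, `n * log (1 / (1 - x)) ≥ (1 - o(1)) * d * ξ * log p` (`eventually_mul_log_le`).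
The number `(2 * π * e) ^ 2 > 1` in the theorem absorbs the factor `1 - o(1)`.
-/

noncomputable section

/-! ### Counting regular graphs by switchings -/

section Switching

variable {V C : Type*}

/-- The switching that replaces the edges `ab` and `ce` of a graph by `ae` and `cb`. -/
def switchEdges (G : SimpleGraph V) (a b c e : V) : SimpleGraph V where
  Adj x y := (G.Adj x y ∧ s(x, y) ≠ s(a, b) ∧ s(x, y) ≠ s(c, e)) ∨
    (x ≠ y ∧ (s(x, y) = s(a, e) ∨ s(x, y) = s(c, b)))
  symm := ⟨fun x y h => by
    rwa [Sym2.eq_swap (a := y) (b := x), G.adj_comm y x, ne_comm (a := y)]⟩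
  loopless := ⟨fun x h => by simp at h⟩

variable [Fintype V]

open Classical in
/-- The ordered pairs of adjacent vertices. Every edge is counted twice. -/
def dartFinset (U : SimpleGraph V) : Finset (V × V) :=
  Finset.univ.filter fun e => U.Adj e.1 e.2

open Classical in
lemma isRegularOfDegree_switchEdges {G : SimpleGraph V} {d : ℕ} (hG : G.IsRegularOfDegree d)
    {a b c e : V} (hab : G.Adj a b) (hce : G.Adj c e) (hae : ¬ G.Adj a e) (hcb : ¬ G.Adj c b)
    (hae' : a ≠ e) (hcb' : c ≠ b) : (switchEdges G a b c e).IsRegularOfDegree d := by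
  have key : ∀ v x y, G.Adj v x → ¬ G.Adj v y →
      (∀ w, (switchEdges G a b c e).Adj v w ↔ w = y ∨ (w ≠ x ∧ G.Adj v w)) →
      (switchEdges G a b c e).degree v = d := by
    intro v x y hx hy h
    have : (switchEdges G a b c e).neighborFinset v = insert y ((G.neighborFinset v).erase x) := by
      ext w; simp [h w]
    rw [← SimpleGraph.card_neighborFinset_eq_degree, this,
      Finset.card_insert_of_notMem (by simp [hy]), Finset.card_erase_add_one (by simpa using hx),
      SimpleGraph.card_neighborFinset_eq_degree, hG v]
  have hac : a ≠ c := fun h => hae (h ▸ hce)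
  have hbe : b ≠ e := fun h => hae (h ▸ hab)
  have h1 := hab.ne
  have h2 := hce.ne
  intro v
  by_cases hva : v = a
  · subst hva
    refine key v b e hab hae fun w => ?_
    simp only [switchEdges, ne_eq, Sym2.eq_iff]
    grind
  by_cases hvb : v = b
  · subst hvb
    refine key v a c hab.symm (fun h => hcb h.symm) fun w => ?_
    simp only [switchEdges, ne_eq, Sym2.eq_iff]
    grind
  by_cases hvc : v = c
  · subst hvc
    refine key v e b hce hcb fun w => ?_
    simp only [switchEdges, ne_eq, Sym2.eq_iff]
    grind
  by_cases hve : v = e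
  · subst hve
    refine key v c a hce.symm (fun h => hae h.symm) fun w => ?_
    simp only [switchEdges, ne_eq, Sym2.eq_iff]
    grind
  rw [← hG v, ← SimpleGraph.card_neighborFinset_eq_degree,
    ← SimpleGraph.card_neighborFinset_eq_degree]
  congr 1
  ext w
  rw [SimpleGraph.mem_neighborFinset, SimpleGraph.mem_neighborFinset]
  simp only [switchEdges, ne_eq, Sym2.eq_iff]
  grind

open Classical in
/-- The `d`-regular graphs that have the same edges as `G` between different cells, and that keep
all the edges of `G` outside `U`. The graph `U` holds the edges that may still be switched. -/
def rewirings (cell : V → C) (d : ℕ) (G U : SimpleGraph V) : Finset (SimpleGraph V) :=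
  Finset.univ.filter fun H => H.IsRegularOfDegree d ∧
    (∀ x y, cell x ≠ cell y → (H.Adj x y ↔ G.Adj x y)) ∧ ∀ x y, G.Adj x y → ¬ U.Adj x y → H.Adj x y

lemma mem_rewirings {cell : V → C} {d : ℕ} {G U H : SimpleGraph V} :
    H ∈ rewirings cell d G U ↔ (open Classical in H.IsRegularOfDegree d) ∧
    (∀ x y, cell x ≠ cell y → (H.Adj x y ↔ G.Adj x y)) ∧
    ∀ x y, G.Adj x y → ¬ U.Adj x y → H.Adj x y := by
  classical
  simp [rewirings]

lemma rewirings_switchEdges_subset {cell : V → C} {d : ℕ} {G U : SimpleGraph V}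
    {a b c e : V} (hab : U.Adj a b) (hce : U.Adj c e)
    (hb : cell b = cell a) (hc : cell c = cell a) (he : cell e = cell a) :
    rewirings cell d (switchEdges G a b c e) (U.deleteEdges {s(a, b), s(c, e)}) ⊆
      rewirings cell d G U := by
  intro H hH
  rw [mem_rewirings] at hH ⊢
  obtain ⟨h1, h2, h3⟩ := hH
  refine ⟨h1, fun x y hxy => ?_, fun x y hxy hU => ?_⟩
  · rw [h2 x y hxy]
    simp only [switchEdges, ne_eq, Sym2.eq_iff]
    grind
  · have hn1 : s(x, y) ≠ s(a, b) := fun h => hU <| by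
      rw [← SimpleGraph.mem_edgeSet, h]; exact hab
    have hn2 : s(x, y) ≠ s(c, e) := fun h => hU <| by
      rw [← SimpleGraph.mem_edgeSet, h]; exact hce
    refine h3 x y (Or.inl ⟨hxy, hn1, hn2⟩) fun h => hU ?_
    exact (SimpleGraph.deleteEdges_adj.1 h).1

lemma card_dartFinset_le_deleteEdges (U : SimpleGraph V) (a b c e : V) :
    (dartFinset U).card ≤ (dartFinset (U.deleteEdges {s(a, b), s(c, e)})).card + 4 := by
  classical
  have : dartFinset U ⊆ dartFinset (U.deleteEdges {s(a, b), s(c, e)}) ∪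
      {(a, b), (b, a), (c, e), (e, c)} := by
    rintro ⟨x, y⟩ h
    simp only [dartFinset, Finset.mem_filter, Finset.mem_univ, true_and, Finset.mem_union,
      SimpleGraph.deleteEdges_adj, Finset.mem_insert, Finset.mem_singleton, Set.mem_insert_iff,
      Set.mem_singleton_iff, Prod.mk.injEq, Sym2.eq_iff] at h ⊢
    tauto
  exact (Finset.card_le_card this).trans ((Finset.card_union_le _ _).trans
    (Nat.add_le_add_left Finset.card_le_four _))

open Classical in
/-- Among the darts of a `d`-regular graph, at most `d * (d + 1)` end in the closed neighbourhood
of a vertex. -/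
lemma card_darts_into_closedNeighborhood {G : SimpleGraph V} {d : ℕ}
    (hG : G.IsRegularOfDegree d) (a : V) :
    (Finset.univ.filter fun f : V × V => G.Adj f.1 f.2 ∧ (f.2 = a ∨ G.Adj a f.2)).card ≤
      d * (d + 1) := by
  have : (Finset.univ.filter fun f : V × V => G.Adj f.1 f.2 ∧ (f.2 = a ∨ G.Adj a f.2)) ⊆
      (insert a (G.neighborFinset a)).biUnion fun v => (G.neighborFinset v).image fun u => (u, v) := by
    rintro ⟨u, v⟩ h
    simp only [Finset.mem_filter, Finset.mem_univ, true_and] at h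
    simp only [Finset.mem_biUnion, Finset.mem_insert, SimpleGraph.mem_neighborFinset,
      Finset.mem_image, Prod.mk.injEq]
    exact ⟨v, h.2, u, h.1.symm, rfl, rfl⟩
  refine (Finset.card_le_card this).trans (Finset.card_biUnion_le.trans ?_)
  refine (Finset.sum_le_card_nsmul _ _ d fun v _ => Finset.card_image_le.trans ?_).trans ?_
  · rw [SimpleGraph.card_neighborFinset_eq_degree, hG v]
  · rw [smul_eq_mul, mul_comm]
    refine Nat.mul_le_mul_left _ ((Finset.card_insert_le _ _).trans ?_)
    rw [SimpleGraph.card_neighborFinset_eq_degree, hG a]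

open Classical in
/-- Counting by switchings. As long as some cell holds more than `L + 2 * d * (d + 1)` darts of
`U`, an edge of it can be switched with at least `L` partners, and the outcome `H` leaves at most
`d * d` possibilities for the partner `ce` of `ab`, because `e` is a neighbour of `a` in `H` and
`c` a neighbour of `e` in `G`. Every switching uses up four darts. -/
theorem pow_le_card_rewirings [Fintype C] (cell : V → C) (d L : ℕ) (T : ℕ) :
    ∀ G U : SimpleGraph V, G.IsRegularOfDegree d → U ≤ G → (∀ x y, U.Adj x y → cell x = cell y) →
      Fintype.card C * (L + 2 * (d * (d + 1))) + 4 * T ≤ (dartFinset U).card →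
      L ^ T ≤ (d * d) ^ T * (rewirings cell d G U).card := by
  induction T with
  | zero =>
    intro G U hG hU hc _
    have : G ∈ rewirings cell d G U := by
      rw [mem_rewirings]
      exact ⟨hG, fun _ _ _ => Iff.rfl, fun _ _ h _ => h⟩
    simpa using Finset.card_pos.2 ⟨G, this⟩
  | succ T ih =>
    intro G U hG hU hcell hcard
    obtain ⟨k, -, hk⟩ := Finset.exists_lt_card_fiber_of_mul_lt_card_of_maps_to
      (s := dartFinset U) (t := (Finset.univ : Finset C)) (f := fun f => cell f.1)
      (n := L + 2 * (d * (d + 1))) (fun _ _ => Finset.mem_univ _)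
      (by rw [Finset.card_univ]; omega)
    set F := (dartFinset U).filter fun f => cell f.1 = k with hF
    obtain ⟨⟨a, b⟩, habF⟩ := Finset.card_pos.1 (Nat.zero_lt_of_lt hk)
    have memF : ∀ f, f ∈ F ↔ U.Adj f.1 f.2 ∧ cell f.1 = k := fun f => by simp [hF, dartFinset]
    obtain ⟨hab, hak⟩ := (memF _).1 habF
    simp only at hab hak
    have hbk : cell b = k := (hcell _ _ hab).symm.trans hak
    set B := F.filter fun f => ¬ (f.2 = a ∨ G.Adj a f.2) ∧ ¬ (f.1 = b ∨ G.Adj b f.1) with hB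
    have hBL : L ≤ B.card := by
      have h1 := card_darts_into_closedNeighborhood hG a
      have h2 := card_darts_into_closedNeighborhood hG b
      set X := Finset.univ.filter fun f : V × V => G.Adj f.1 f.2 ∧ (f.2 = a ∨ G.Adj a f.2)
      set Y := Finset.univ.filter fun f : V × V => G.Adj f.1 f.2 ∧ (f.2 = b ∨ G.Adj b f.2)
      have hsub : F ⊆ B ∪ (X ∪ Y.image Prod.swap) := by
        rintro ⟨u, v⟩ hf
        have := (memF _).1 hf
        have hG' := hU this.1
        simp only [hB, X, Y, Finset.mem_union, Finset.mem_filter, hf, true_and, Finset.mem_univ,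
          Finset.mem_image, Prod.exists, Prod.swap_prod_mk, Prod.mk.injEq]
        by_cases hx : v = a ∨ G.Adj a v
        · exact Or.inr (Or.inl ⟨hG', hx⟩)
        by_cases hy : u = b ∨ G.Adj b u
        · exact Or.inr (Or.inr ⟨v, u, ⟨hG'.symm, hy⟩, rfl, rfl⟩)
        · exact Or.inl ⟨hx, hy⟩
      have h3 := Finset.card_le_card hsub
      have h4 := Finset.card_union_le B (X ∪ Y.image Prod.swap)
      have h5 := Finset.card_union_le X (Y.image Prod.swap)
      have h6 : (Y.image Prod.swap).card ≤ Y.card := Finset.card_image_le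
      omega
    set R : V × V → Finset (SimpleGraph V) := fun f =>
      rewirings cell d (switchEdges G a b f.1 f.2) (U.deleteEdges {s(a, b), s(f.1, f.2)}) with hR
    have memB : ∀ f ∈ B, U.Adj f.1 f.2 ∧ cell f.1 = k ∧ cell f.2 = k ∧ f.2 ≠ a ∧ ¬ G.Adj a f.2 ∧
        f.1 ≠ b ∧ ¬ G.Adj b f.1 := by
      intro f hf
      rw [hB, Finset.mem_filter, memF] at hf
      have := hcell _ _ hf.1.1
      grind
    have hstep : ∀ f ∈ B, L ^ T ≤ (d * d) ^ T * (R f).card := by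
      intro f hf
      obtain ⟨h1, h2, h3, h4, h5, h6, h7⟩ := memB f hf
      refine ih _ _ ?_ ?_ ?_ ?_
      · exact isRegularOfDegree_switchEdges hG (hU hab) (hU h1) h5 (fun h => h7 h.symm) h4.symm h6
      · intro x y hxy
        rw [SimpleGraph.deleteEdges_adj] at hxy
        simp only [Set.mem_insert_iff, Set.mem_singleton_iff, not_or] at hxy
        exact Or.inl ⟨hU hxy.1, hxy.2⟩
      · intro x y hxy
        exact hcell x y (SimpleGraph.deleteEdges_adj.1 hxy).1
      · have := card_dartFinset_le_deleteEdges U a b f.1 f.2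
        omega
    have hRsub : ∀ f ∈ B, R f ⊆ rewirings cell d G U := by
      intro f hf
      obtain ⟨h1, h2, h3, -⟩ := memB f hf
      exact rewirings_switchEdges_subset hab h1 (by rw [hbk, hak]) (by rw [h2, hak])
        (by rw [h3, hak])
    have hmult : ∑ f ∈ B, (R f).card ≤ (rewirings cell d G U).card * (d * d) := by
      have : ∑ f ∈ B, (R f).card =
          ∑ H ∈ rewirings cell d G U, (B.filter fun f => H ∈ R f).card := by
        refine Eq.trans (Finset.sum_congr rfl fun f hf => ?_)
          (Finset.sum_card_bipartiteAbove_eq_sum_card_bipartiteBelow fun f H => H ∈ R f)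
        congr 1
        ext H
        simp only [Finset.bipartiteAbove, Finset.mem_filter]
        exact ⟨fun h => ⟨hRsub f hf h, h⟩, fun h => h.2⟩
      rw [this, ← smul_eq_mul]
      refine Finset.sum_le_card_nsmul _ _ _ fun H hH => ?_
      have hHd := (mem_rewirings.1 hH).1
      have : (B.filter fun f => H ∈ R f) ⊆
          (H.neighborFinset a).biUnion fun v => (G.neighborFinset v).image fun u => (u, v) := by
        rintro ⟨u, v⟩ hf
        rw [Finset.mem_filter] at hf
        obtain ⟨h1, h2, h3, h4, h5, h6, h7⟩ := memB _ hf.1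
        have h8 := (mem_rewirings.1 hf.2).2.2 a v
          (Or.inr ⟨fun h => h4 h.symm, Or.inl rfl⟩)
          (fun h => h5 (hU (SimpleGraph.deleteEdges_adj.1 h).1))
        simp only [Finset.mem_biUnion, SimpleGraph.mem_neighborFinset, Finset.mem_image,
          Prod.mk.injEq]
        exact ⟨v, h8, u, (hU h1).symm, rfl, rfl⟩
      refine (Finset.card_le_card this).trans (Finset.card_biUnion_le.trans ?_)
      refine (Finset.sum_le_card_nsmul _ _ d fun v _ => Finset.card_image_le.trans ?_).trans ?_
      · rw [SimpleGraph.card_neighborFinset_eq_degree, hG v]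
      · rw [SimpleGraph.card_neighborFinset_eq_degree, hHd a, smul_eq_mul]
    calc L ^ (T + 1) = L * L ^ T := by rw [pow_succ, mul_comm]
      _ ≤ B.card * L ^ T := Nat.mul_le_mul_right _ hBL
      _ = ∑ _f ∈ B, L ^ T := by rw [Finset.sum_const, smul_eq_mul]
      _ ≤ ∑ f ∈ B, (d * d) ^ T * (R f).card := Finset.sum_le_sum hstep
      _ = (d * d) ^ T * ∑ f ∈ B, (R f).card := by rw [Finset.mul_sum]
      _ ≤ (d * d) ^ T * ((rewirings cell d G U).card * (d * d)) := Nat.mul_le_mul_left _ hmult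
      _ = (d * d) ^ (T + 1) * (rewirings cell d G U).card := by ring

end Switching

/-! ### Domination of a Gaussian law by a wider isotropic one -/

section Gaussian

variable {E : Type*} [NormedAddCommGroup E] [InnerProductSpace ℝ E] [FiniteDimensional ℝ E]
  [MeasurableSpace E] [BorelSpace E]

/-- The standard Gaussian measure has density proportional to `exp (- ‖x‖ ^ 2 / 2)`. -/
lemma stdGaussian_eq_withDensity : ∃ k : ℝ, 0 ≤ k ∧ stdGaussian E =
    (volume : Measure E).withDensity
      fun x => ENNReal.ofReal (k * Real.exp (-(1 / 2) * ‖x‖ ^ 2)) := by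
  set Z : ℝ := (Real.pi / (1 / 2)) ^ (Module.finrank ℝ E / 2 : ℝ) with hZ
  have hZ0 : 0 < Z := by positivity
  have hint : ∫ x : E, Real.exp (-(1 / 2) * ‖x‖ ^ 2) = Z :=
    GaussianFourier.integral_rexp_neg_mul_sq_norm (by norm_num)
  have hI : Integrable fun x : E => Z⁻¹ * Real.exp (-(1 / 2) * ‖x‖ ^ 2) := by
    refine Integrable.const_mul ?_ _
    by_contra h
    rw [integral_undef h] at hint
    exact hZ0.ne hint
  refine ⟨Z⁻¹, by positivity, ?_⟩
  have hfin : IsFiniteMeasure ((volume : Measure E).withDensity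
      fun x => ENNReal.ofReal (Z⁻¹ * Real.exp (-(1 / 2) * ‖x‖ ^ 2))) :=
    isFiniteMeasure_withDensity_ofReal hI.2
  apply Measure.ext_of_charFun
  ext t
  rw [charFun_stdGaussian, charFun_apply,
    integral_withDensity_eq_integral_toReal_smul (by fun_prop) (by simp)]
  have h1 : ∀ x : E, (ENNReal.ofReal (Z⁻¹ * Real.exp (-(1 / 2) * ‖x‖ ^ 2))).toReal •
      Complex.exp (↑(inner ℝ x t) * Complex.I) =
      ((Z⁻¹ : ℝ) : ℂ) * Complex.exp (-(1 / 2 : ℂ) * ‖x‖ ^ 2 + Complex.I * ↑(inner ℝ t x)) := by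
    intro x
    rw [ENNReal.toReal_ofReal (by positivity), Complex.real_smul, Complex.exp_add,
      real_inner_comm, mul_comm Complex.I]
    push_cast
    ring
  simp_rw [h1]
  rw [integral_const_mul, GaussianFourier.integral_cexp_neg_mul_sq_norm_add (by norm_num), hZ,
    ← mul_assoc]
  have h2 : (((Real.pi / (1 / 2)) ^ (Module.finrank ℝ E / 2 : ℝ) : ℝ) : ℂ) =
      ((Real.pi : ℂ) / (1 / 2)) ^ (Module.finrank ℝ E / 2 : ℂ) := by
    rw [Complex.ofReal_cpow (by positivity)]
    push_cast
    rfl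
  rw [Complex.ofReal_inv, h2, inv_mul_cancel₀, one_mul]
  · congr 1
    rw [Complex.I_sq]
    ring
  · rw [← h2]
    exact_mod_cast hZ0.ne'

/-- A linear contraction does not lower the density of the standard Gaussian measure, except for
the volume factor. -/
lemma map_stdGaussian_le_of_contraction (A : E ≃L[ℝ] E) (hA : ∀ x, ‖A x‖ ≤ ‖x‖) :
    (stdGaussian E).map A ≤
      ENNReal.ofReal |(LinearMap.det (A : E →ₗ[ℝ] E))⁻¹| • stdGaussian E := by
  obtain ⟨k, hk, h⟩ := stdGaussian_eq_withDensity (E := E)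
  rw [Measure.le_iff]
  intro s hs
  set f : E → ENNReal := fun x => ENNReal.ofReal (k * Real.exp (-(1 / 2) * ‖x‖ ^ 2)) with hf
  have hfm : Measurable f := by fun_prop
  have hdet : LinearMap.det (A : E →ₗ[ℝ] E) ≠ 0 := A.toLinearEquiv.isUnit_det'.ne_zero
  rw [Measure.map_apply A.continuous.measurable hs, Measure.smul_apply, h,
    withDensity_apply _ (A.continuous.measurable hs), withDensity_apply _ hs]
  calc ∫⁻ x in A ⁻¹' s, f x ≤ ∫⁻ x in A ⁻¹' s, f (A x) := by
        refine lintegral_mono fun x => ?_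
        refine ENNReal.ofReal_le_ofReal (mul_le_mul_of_nonneg_left (Real.exp_le_exp.2 ?_) hk)
        have := pow_le_pow_left₀ (norm_nonneg _) (hA x) 2
        linarith
    _ = ∫⁻ y in s, f y ∂((volume : Measure E).map A) :=
        (setLIntegral_map hs hfm A.continuous.measurable).symm
    _ = _ := by
        have := Measure.map_linearMap_addHaar_eq_smul_addHaar (volume : Measure E) hdet
        have h3 : (volume : Measure E).map A =
          ENNReal.ofReal |(LinearMap.det (A : E →ₗ[ℝ] E))⁻¹| • volume := this
        rw [h3, Measure.restrict_smul, lintegral_smul_measure]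

end Gaussian

/-- Product measures are monotone in their factors. -/
lemma MeasureTheory.Measure.pi_mono_of_le {ι : Type*} [Fintype ι] {X : ι → Type*}
    [∀ i, MeasurableSpace (X i)]
    {μ ν : ∀ i, Measure (X i)} [∀ i, SigmaFinite (μ i)] [∀ i, SigmaFinite (ν i)]
    (h : ∀ i, μ i ≤ ν i) : Measure.pi μ ≤ Measure.pi ν := by
  rw [Measure.le_iff]
  intro s hs
  have hle : (Measure.pi μ).toOuterMeasure ≤ OuterMeasure.pi fun i => (ν i).toOuterMeasure := by
    rw [OuterMeasure.le_pi]
    intro t _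
    change Measure.pi μ (Set.univ.pi t) ≤ _
    rw [Measure.pi_pi]
    exact Finset.prod_le_prod' fun i _ => Measure.le_iff'.1 (h i) (t i)
  rw [Measure.pi_def ν, toMeasure_apply _ _ hs]
  exact hle s

/-- Domination of the factors up to a constant `c` gives domination of the product measures up to
a power of `c`. -/
lemma MeasureTheory.Measure.pi_le_smul_pi {ι : Type*} [Fintype ι] {X : ι → Type*} [∀ i, MeasurableSpace (X i)]
    {μ ν : ∀ i, Measure (X i)} [∀ i, SigmaFinite (μ i)] [∀ i, IsFiniteMeasure (ν i)] (c : NNReal)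
    (h : ∀ i, μ i ≤ c • ν i) : Measure.pi μ ≤ c ^ Fintype.card ι • Measure.pi ν := by
  have : Measure.pi (fun i => c • ν i) = c ^ Fintype.card ι • Measure.pi ν := by
    refine Measure.pi_eq fun s _ => ?_
    simp only [Measure.smul_apply, Measure.pi_pi, ENNReal.smul_def, smul_eq_mul,
      Finset.prod_mul_distrib, Finset.prod_const, Finset.card_univ, ENNReal.coe_pow]
  rw [← this]
  exact Measure.pi_mono_of_le h

/-! ### Gaussian laws with diagonally dominant precision matrix -/

section Matrix

variable {ι : Type*} [Fintype ι] [DecidableEq ι]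

open Matrix in
/-- A symmetric matrix with unit diagonal whose off-diagonal absolute row sums are at most `x` is
bounded below by `1 - x` as a quadratic form. -/
lemma one_sub_mul_dotProduct_le {J : Matrix ι ι ℝ} {x : ℝ} (hsymm : ∀ i j, J i j = J j i)
    (hdiag : ∀ i, J i i = 1) (hrow : ∀ i, ∑ j, (if i = j then 0 else |J i j|) ≤ x) (v : ι → ℝ) :
    (1 - x) * (v ⬝ᵥ v) ≤ v ⬝ᵥ J *ᵥ v := by
  set K : ι → ι → ℝ := fun i j => if i = j then 0 else |J i j| with hK
  have hKs : ∀ i j, K i j = K j i := fun i j => by simp [hK, eq_comm (a := i), hsymm i j]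
  have hterm : ∀ i j, (if i = j then v i ^ 2 else 0) - K i j * v i ^ 2 / 2 - K j i * v j ^ 2 / 2 ≤
      v i * (J i j * v j) := by
    intro i j
    rw [hKs j i]
    by_cases h : i = j
    · subst h
      simp [hK, hdiag, sq]
    · simp only [hK, h, if_false]
      have h1 : -(|J i j| * |v i * v j|) ≤ J i j * (v i * v j) := by
        rw [← abs_mul]; exact neg_abs_le _
      have h2 : |v i * v j| ≤ (v i ^ 2 + v j ^ 2) / 2 := by
        rw [abs_le]
        constructor <;> nlinarith [sq_nonneg (v i - v j), sq_nonneg (v i + v j)]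
      nlinarith [mul_le_mul_of_nonneg_left h2 (abs_nonneg (J i j))]
  have hsum : ∑ i, ∑ j, ((if i = j then v i ^ 2 else 0) - K i j * v i ^ 2 / 2
      - K j i * v j ^ 2 / 2) ≤ v ⬝ᵥ J *ᵥ v := by
    simp only [dotProduct, mulVec, Finset.mul_sum]
    exact Finset.sum_le_sum fun i _ => Finset.sum_le_sum fun j _ => hterm i j
  refine le_trans ?_ hsum
  simp only [Finset.sum_sub_distrib]
  rw [Finset.sum_comm (f := fun i j => K j i * v j ^ 2 / 2)]
  have h3 : ∀ i, ∑ j, K i j * v i ^ 2 / 2 ≤ x * v i ^ 2 / 2 := by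
    intro i
    rw [← Finset.sum_div, ← Finset.sum_mul]
    have := mul_le_mul_of_nonneg_right (hrow i) (sq_nonneg (v i))
    linarith
  have h4 : ∑ i, ∑ j, K i j * v i ^ 2 / 2 ≤ ∑ i, x * v i ^ 2 / 2 :=
    Finset.sum_le_sum fun i _ => h3 i
  have h5 : ∑ i, x * v i ^ 2 / 2 = x * (v ⬝ᵥ v) / 2 := by
    simp only [dotProduct, ← Finset.sum_div, ← Finset.mul_sum, sq]
  have h6 : ∑ i, ∑ j, (if i = j then v i ^ 2 else 0) = v ⬝ᵥ v := by
    simp [dotProduct, sq]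
  rw [h6]
  linarith

/-- A positive definite matrix with unit diagonal has determinant at most one, since
`λ ≤ exp (λ - 1)` for each eigenvalue and the trace is the number of eigenvalues. -/
lemma Matrix.PosDef.det_le_one_of_diag {J : Matrix ι ι ℝ} (hJ : J.PosDef)
    (hdiag : ∀ i, J i i = 1) : J.det ≤ 1 := by
  have htr : ∑ i, hJ.1.eigenvalues i = Fintype.card ι := by
    have := hJ.1.trace_eq_sum_eigenvalues
    simp only [Matrix.trace, Matrix.diag, hdiag] at this
    simpa using this.symm
  have hdet := hJ.1.det_eq_prod_eigenvalues
  simp only [RCLike.ofReal_real_eq_id, id] at hdet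
  rw [hdet]
  calc ∏ i, hJ.1.eigenvalues i ≤ ∏ i, Real.exp (hJ.1.eigenvalues i - 1) :=
        Finset.prod_le_prod (fun i _ => (hJ.eigenvalues_pos i).le)
          fun i _ => by linarith [Real.add_one_le_exp (hJ.1.eigenvalues i - 1)]
    _ = 1 := by
        rw [← Real.exp_sum, Finset.sum_sub_distrib, htr]
        simp

open Matrix in
/-- If `w ⬝ᵥ w ≤ c * (w ⬝ᵥ J *ᵥ w)` for all `w`, then the quadratic form of `J⁻¹` is at most `c`. -/
lemma dotProduct_inv_mulVec_le {J : Matrix ι ι ℝ} (hJ : J.PosDef) {c : ℝ}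
    (hc : ∀ w : ι → ℝ, w ⬝ᵥ w ≤ c * (w ⬝ᵥ J *ᵥ w)) (v : ι → ℝ) :
    v ⬝ᵥ J⁻¹ *ᵥ v ≤ c * (v ⬝ᵥ v) := by
  set w := J⁻¹ *ᵥ v with hw
  have hv : J *ᵥ w = v := by
    rw [hw, Matrix.mulVec_mulVec, Matrix.mul_nonsing_inv _ ((Matrix.isUnit_iff_isUnit_det _).1 hJ.isUnit), Matrix.one_mulVec]
  have hCS : (w ⬝ᵥ v) ^ 2 ≤ (w ⬝ᵥ w) * (v ⬝ᵥ v) := by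
    simp only [dotProduct, ← sq]
    exact Finset.sum_mul_sq_le_sq_mul_sq _ _ _
  have h1 := hc w
  rw [hv] at h1
  have hvv : 0 ≤ v ⬝ᵥ v := by
    simp only [dotProduct]; exact Finset.sum_nonneg fun i _ => mul_self_nonneg _
  have hq : 0 ≤ w ⬝ᵥ v := by
    rw [← hv]
    simpa using hJ.posSemidef.dotProduct_mulVec_nonneg w
  rw [dotProduct_comm]
  rcases hq.eq_or_lt with h0 | hpos
  · by_cases hvz : v = 0
    · simp [hvz]
    · have h2 := hJ.dotProduct_mulVec_pos (x := w) (fun h => hvz (by rw [← hv, h, mulVec_zero]))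
      rw [hv] at h2
      simp only [star_trivial] at h2
      exact absurd h0 h2.ne
  · have := mul_le_mul_of_nonneg_right h1 hvv
    nlinarith

open Matrix MatrixOrder in
/-- If `σ⁻²` is a lower bound of the precision matrix `J`, whose determinant is at most one, then
the density of the Gaussian law is at most `σ ^ p` times that of the isotropic one of
variance `σ ^ 2`. -/
theorem multivariateGaussian_inv_le {J : Matrix ι ι ℝ} (hJ : J.PosDef) (hdet : J.det ≤ 1)
    {σ : ℝ} (hσ : 0 < σ) (hc : ∀ w : ι → ℝ, w ⬝ᵥ w ≤ σ ^ 2 * (w ⬝ᵥ J *ᵥ w)) :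
    multivariateGaussian 0 J⁻¹ ≤ (σ ^ Fintype.card ι).toNNReal •
      (stdGaussian (EuclideanSpace ℝ ι)).map (fun x => σ • x) := by
  set R := CFC.sqrt J⁻¹ with hR
  have hRR : R * R = J⁻¹ := CFC.sqrt_mul_sqrt_self _ hJ.inv.posSemidef.nonneg
  have hRpos : R.PosSemidef := (CFC.sqrt_nonneg J⁻¹).posSemidef
  have hRT : Rᵀ = R := by simpa using hRpos.1.eq
  have hRdet : R.det ^ 2 = (J.det)⁻¹ := by
    rw [sq, ← Matrix.det_mul, hRR, Matrix.det_nonsing_inv, Ring.inverse_eq_inv']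
  have hR1 : 1 ≤ R.det := by
    have h1 : 1 ≤ R.det ^ 2 := by rw [hRdet]; exact (one_le_inv₀ hJ.det_pos).2 hdet
    have h2 : 0 ≤ R.det := hRpos.det_nonneg
    nlinarith
  set A : EuclideanSpace ℝ ι →L[ℝ] EuclideanSpace ℝ ι := toEuclideanCLM (𝕜 := ℝ) (σ⁻¹ • R) with hA
  have hAdet : LinearMap.det (A : EuclideanSpace ℝ ι →ₗ[ℝ] EuclideanSpace ℝ ι) =
      σ⁻¹ ^ Fintype.card ι * R.det := by
    rw [hA, coe_toEuclideanCLM_eq_toEuclideanLin, toEuclideanLin_eq_toLin_orthonormal,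
      LinearMap.det_toLin, Matrix.det_smul]
  have hAdet0 : A.det ≠ 0 := by
    change LinearMap.det (A : EuclideanSpace ℝ ι →ₗ[ℝ] EuclideanSpace ℝ ι) ≠ 0
    rw [hAdet]
    have : 0 < R.det := by linarith
    positivity
  set B := A.toContinuousLinearEquivOfDetNeZero hAdet0 with hB
  have hBA : ∀ x, B x = A x := fun x => rfl
  have hcontr : ∀ x, ‖B x‖ ≤ ‖x‖ := by
    intro x
    refine (pow_le_pow_iff_left₀ (norm_nonneg _) (norm_nonneg _) two_ne_zero).1 ?_
    have h1 := dotProduct_inv_mulVec_le hJ hc x.ofLp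
    have h2 : ‖B x‖ ^ 2 = σ⁻¹ ^ 2 * (x.ofLp ⬝ᵥ J⁻¹ *ᵥ x.ofLp) := by
      have h3 : (B x).ofLp = σ⁻¹ • (R *ᵥ x.ofLp) := by
        rw [hBA, hA, ofLp_toEuclideanCLM, Matrix.smul_mulVec]
      have h4 : ‖B x‖ ^ 2 = (B x).ofLp ⬝ᵥ (B x).ofLp := by
        rw [EuclideanSpace.real_norm_sq_eq]
        simp only [dotProduct, sq]
      have h5 : (R *ᵥ x.ofLp) ⬝ᵥ (R *ᵥ x.ofLp) = x.ofLp ⬝ᵥ J⁻¹ *ᵥ x.ofLp := by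
        rw [← hRR, ← Matrix.mulVec_mulVec, dotProduct_mulVec x.ofLp, ← mulVec_transpose, hRT]
      rw [h4, h3, smul_dotProduct, dotProduct_smul, h5, smul_eq_mul, smul_eq_mul]
      ring
    have h6 : ‖x‖ ^ 2 = x.ofLp ⬝ᵥ x.ofLp := by
      rw [EuclideanSpace.real_norm_sq_eq]
      simp only [dotProduct, sq]
    rw [h2, h6]
    calc σ⁻¹ ^ 2 * (x.ofLp ⬝ᵥ J⁻¹ *ᵥ x.ofLp) ≤ σ⁻¹ ^ 2 * (σ ^ 2 * (x.ofLp ⬝ᵥ x.ofLp)) :=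
          mul_le_mul_of_nonneg_left h1 (by positivity)
      _ = x.ofLp ⬝ᵥ x.ofLp := by
          rw [← mul_assoc, ← mul_pow, inv_mul_cancel₀ hσ.ne', one_pow, one_mul]
  have hle := map_stdGaussian_le_of_contraction B hcontr
  have hcoef : |(LinearMap.det (B : EuclideanSpace ℝ ι →ₗ[ℝ] EuclideanSpace ℝ ι))⁻¹| ≤
      σ ^ Fintype.card ι := by
    have : LinearMap.det (B : EuclideanSpace ℝ ι →ₗ[ℝ] EuclideanSpace ℝ ι) =
      σ⁻¹ ^ Fintype.card ι * R.det := hAdet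
    rw [this, mul_inv, inv_pow, inv_inv, abs_of_nonneg (by positivity)]
    exact mul_le_of_le_one_right (by positivity) (inv_le_one_of_one_le₀ hR1)
  have hmap : multivariateGaussian 0 J⁻¹ =
      ((stdGaussian (EuclideanSpace ℝ ι)).map B).map (fun x => σ • x) := by
    rw [Measure.map_map (by fun_prop) B.continuous.measurable, multivariateGaussian]
    congr 1
    ext1 x
    simp only [Function.comp_apply, hBA, hA, zero_add, map_smul, _root_.smul_apply,
      smul_smul, mul_inv_cancel₀ hσ.ne', one_smul, hR]
  rw [hmap, ← Measure.map_smul]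
  refine Measure.map_mono (hle.trans ?_) (by fun_prop)
  rw [Measure.le_iff]
  intro s _
  rw [Measure.smul_apply, Measure.smul_apply]
  exact mul_le_mul_left (ENNReal.ofReal_le_ofReal hcoef) _

end Matrix

/-! ### The local regular graphs on the vertices of a domain -/

namespace Domain

variable {p S : ℕ} (D : Domain p)

open Classical in
/-- The graphs of the family: `d`-regular with local connections. -/
def localGraphs (d : ℕ) (ε : ℝ) : Finset (SimpleGraph (Fin p)) :=
  Finset.univ.filter fun G => G.IsRegularOfDegree d ∧ D.IsLocal d ε G

open Classical in
/-- The partition and the graph of a model are chosen independently of each other. -/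
lemma family_eq_product (M : ModelParams S) (δ ε : ℝ) :
    D.family M δ ε =
      (Finset.univ.filter fun lab => D.IsAdmissiblePartition M δ lab) ×ˢ D.localGraphs M.d ε := by
  ext g
  simp [family, localGraphs]

/-- The edges of a graph that stay inside a cell of the domain. -/
def intracellular (G : SimpleGraph (Fin p)) : SimpleGraph (Fin p) where
  Adj x y := G.Adj x y ∧ D.vertexCell x = D.vertexCell y
  symm := ⟨fun _ _ h => ⟨h.1.symm, h.2.symm⟩⟩
  loopless := ⟨fun _ h => h.1.ne rfl⟩

lemma latticeSquare_one (a : ℤ × ℤ) : latticeSquare a 1 = {a} := by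
  ext ⟨x, y⟩
  simp only [latticeSquare, Finset.mem_product, Finset.mem_Ico, Finset.mem_singleton, Prod.ext_iff]
  push_cast
  omega

lemma mem_verticesIn {H : Finset (ℤ × ℤ)} {i : Fin p} :
    i ∈ D.verticesIn H ↔ (D.vertexCell i : ℤ × ℤ) ∈ H := by
  simp [verticesIn]

lemma sum_card_verticesIn : ∑ c ∈ D.cells, (D.verticesIn {c}).card = p := by
  have h := Finset.card_eq_sum_card_fiberwise (s := (Finset.univ : Finset (Fin p))) (t := D.cells)
    (f := fun i => (D.vertexCell i : ℤ × ℤ)) (fun i _ => (D.vertexCell i).2)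
  rw [Finset.card_univ, Fintype.card_fin] at h
  conv_rhs => rw [h]
  refine Finset.sum_congr rfl fun c _ => ?_
  congr 1
  ext i
  simp [mem_verticesIn]

/-- Locality only concerns edges between different cells. -/
lemma rewirings_intracellular_subset {d : ℕ} {ε : ℝ} {G U : SimpleGraph (Fin p)}
    (hG : G ∈ D.localGraphs d ε) :
    rewirings D.vertexCell d G U ⊆ D.localGraphs d ε := by
  classical
  intro H hH
  obtain ⟨h1, h2, -⟩ := mem_rewirings.1 hH
  simp only [localGraphs, Finset.mem_filter, Finset.mem_univ, true_and] at hG ⊢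
  refine ⟨h1, fun a t ht hsq => ?_⟩
  refine le_trans (le_of_eq ?_) (hG.2 a t ht hsq)
  refine congrArg _ (congrArg _ (Finset.filter_congr fun e he => h2 _ _ fun h => ?_))
  simp only [Finset.mem_product, Finset.mem_compl, mem_verticesIn] at he
  exact he.2 (h ▸ he.1)

lemma card_dartFinset_of_regular {G : SimpleGraph (Fin p)} {d : ℕ}
    (hG : open Classical in G.IsRegularOfDegree d) : (dartFinset G).card = d * p := by
  classical
  rw [dartFinset, Finset.card_filter, Fintype.sum_prod_type]
  have : ∀ x : Fin p, ∑ y, (if G.Adj x y then 1 else 0) = d := by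
    intro x
    rw [← Finset.card_filter, ← hG x, ← SimpleGraph.card_neighborFinset_eq_degree]
    congr 1
    ext y
    simp
  simp [this, mul_comm]

/-- The locality condition for single cells bounds the number of edges between different cells. -/
lemma card_dartFinset_intracellular_ge {G : SimpleGraph (Fin p)} {d : ℕ} {ε : ℝ}
    (hG : G ∈ D.localGraphs d ε) :
    (d * p : ℝ) - |ε| * d * p ≤ (dartFinset (D.intracellular G)).card := by
  classical
  simp only [localGraphs, Finset.mem_filter, Finset.mem_univ, true_and] at hG
  set O : ℤ × ℤ → Finset (Fin p × Fin p) := fun c =>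
    (D.verticesIn {c} ×ˢ (D.verticesIn {c})ᶜ).filter fun e => G.Adj e.1 e.2 with hO
  have hsub : dartFinset G ⊆ dartFinset (D.intracellular G) ∪ D.cells.biUnion O := by
    rintro ⟨x, y⟩ h
    simp only [dartFinset, Finset.mem_filter, Finset.mem_univ, true_and] at h
    rw [Finset.mem_union]
    by_cases hc : D.vertexCell x = D.vertexCell y
    · left
      simp only [dartFinset, Finset.mem_filter, Finset.mem_univ, true_and]
      exact ⟨h, hc⟩
    · right
      rw [Finset.mem_biUnion]
      refine ⟨D.vertexCell x, (D.vertexCell x).2, ?_⟩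
      simp only [hO, Finset.mem_filter, Finset.mem_product, mem_verticesIn, Finset.mem_singleton,
        Finset.mem_compl, true_and]
      exact ⟨fun h' => hc (Subtype.ext h'.symm), h⟩
  have hcard := (Finset.card_le_card hsub).trans ((Finset.card_union_le _ _).trans
    (Nat.add_le_add_left Finset.card_biUnion_le _))
  rw [card_dartFinset_of_regular hG.1] at hcard
  have hOc : ∀ c ∈ D.cells, ((O c).card : ℝ) ≤ |ε| * d * (D.verticesIn {c}).card := by
    intro c hc
    have h1 := hG.2 c 1 le_rfl (by rw [latticeSquare_one]; simpa using hc)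
    rw [latticeSquare_one] at h1
    refine h1.trans ?_
    have h2 : √((D.verticesIn {c}).card : ℝ) ≤ (D.verticesIn {c}).card := by
      rw [Real.sqrt_le_left (by positivity)]
      exact_mod_cast Nat.le_self_pow two_ne_zero _
    refine mul_le_mul ?_ h2 (Real.sqrt_nonneg _) (by positivity)
    exact mul_le_mul_of_nonneg_right (le_abs_self ε) (by positivity)
  have hsum : ((∑ c ∈ D.cells, (O c).card : ℕ) : ℝ) ≤ |ε| * d * p := by
    push_cast
    refine (Finset.sum_le_sum hOc).trans_eq ?_
    rw [← Finset.mul_sum]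
    congr 1
    exact_mod_cast D.sum_card_verticesIn
  have h3 : ((d * p : ℕ) : ℝ) ≤ ((dartFinset (D.intracellular G)).card : ℝ) +
      ((∑ c ∈ D.cells, (O c).card : ℕ) : ℝ) := by exact_mod_cast hcard
  push_cast at h3 hsum
  linarith

/-- The number of local regular graphs, as soon as there is one. -/
theorem pow_le_card_localGraphs {d : ℕ} {ε : ℝ} (hne : (D.localGraphs d ε).Nonempty) {L T : ℕ}
    (h : (D.cells.card : ℝ) * (L + 2 * (d * (d + 1))) + 4 * T + |ε| * d * p ≤ d * p) :
    L ^ T ≤ (d * d) ^ T * (D.localGraphs d ε).card := by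
  classical
  obtain ⟨G, hG⟩ := hne
  have hreg : G.IsRegularOfDegree d := by
    simp only [localGraphs, Finset.mem_filter, Finset.mem_univ, true_and] at hG
    exact hG.1
  have h1 := D.card_dartFinset_intracellular_ge hG
  have h2 : Fintype.card D.cells * (L + 2 * (d * (d + 1))) + 4 * T ≤
      (dartFinset (D.intracellular G)).card := by
    rw [Fintype.card_coe]
    have : (D.cells.card : ℝ) * (L + 2 * (d * (d + 1))) + 4 * T ≤
      (dartFinset (D.intracellular G)).card := by linarith
    exact_mod_cast this
  have hreg' : open Classical in G.IsRegularOfDegree d := by convert hreg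
  refine (pow_le_card_rewirings D.vertexCell d L T G (D.intracellular G) hreg'
    (fun _ _ hxy => hxy.1) (fun _ _ hxy => hxy.2) h2).trans ?_
  exact Nat.mul_le_mul_left _ (Finset.card_le_card (D.rewirings_intracellular_subset hG))

end Domain

/-! ### The error probability and the number of graphs -/

lemma ModelParams.θ_le_θmax {S : ℕ} (M : ModelParams S) (s : Fin S) : M.θ s ≤ M.θmax :=
  le_ciSup (Set.finite_range M.θ).bddAbove s

lemma ModelParams.θmax_pos {S : ℕ} (M : ModelParams S) : 0 < M.θmax :=
  (M.θ_pos ⟨0, M.S_pos⟩).trans_le (M.θ_le_θmax _)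

lemma ModelParams.mul_θmax_lt_one {S : ℕ} (M : ModelParams S) : M.d * M.θmax < 1 := by
  have : Nonempty (Fin S) := ⟨⟨0, M.S_pos⟩⟩
  obtain ⟨s, hs⟩ := exists_eq_ciSup_of_finite (f := M.θ)
  rw [ModelParams.θmax, ← hs]
  exact M.corr_decay s

namespace Domain

variable {p S : ℕ} (D : Domain p)

open Classical in
lemma precision_symm (M : ModelParams S) (g : (D.cells → Fin S) × SimpleGraph (Fin p))
    (i j : Fin p) : D.precision M g i j = D.precision M g j i := by
  simp only [precision, Matrix.of_apply, eq_comm (a := j) (b := i), g.2.adj_comm j i]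
  rw [add_comm]

lemma precision_diag (M : ModelParams S) (g : (D.cells → Fin S) × SimpleGraph (Fin p))
    (i : Fin p) : D.precision M g i i = 1 := by
  simp [precision]

open Classical in
lemma sum_abs_precision_le (M : ModelParams S) {g : (D.cells → Fin S) × SimpleGraph (Fin p)}
    (hg : g.2.IsRegularOfDegree M.d) (i : Fin p) :
    ∑ j, (if i = j then 0 else |D.precision M g i j|) ≤ M.d * M.θmax := by
  have h1 : ∀ j, (if i = j then 0 else |D.precision M g i j|) ≤
      if g.2.Adj i j then M.θmax else 0 := by
    intro j
    by_cases hij : i = j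
    · simp [hij]
    · by_cases ha : g.2.Adj i j
      · have h2 := M.θ_le_θmax (g.1 (D.vertexCell i))
        have h3 := M.θ_le_θmax (g.1 (D.vertexCell j))
        have h4 := M.θ_pos (g.1 (D.vertexCell i))
        have h5 := M.θ_pos (g.1 (D.vertexCell j))
        simp only [hij, ha, if_false, if_true, precision, Matrix.of_apply]
        rw [abs_of_pos (by linarith)]
        linarith
      · simp [hij, ha, precision]
  refine (Finset.sum_le_sum fun j _ => h1 j).trans_eq ?_
  rw [← Finset.sum_filter, Finset.sum_const, nsmul_eq_mul]
  congr 2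
  rw [← hg i, ← SimpleGraph.card_neighborFinset_eq_degree]
  congr 1
  ext j
  simp

open Classical in
/-- All models of the family are dominated by one and the same isotropic Gaussian law. -/
lemma sampleLaw_le (M : ModelParams S) {g : (D.cells → Fin S) × SimpleGraph (Fin p)}
    (hg : g.2.IsRegularOfDegree M.d) (n : ℕ) {σ : ℝ} (hσ : 0 < σ)
    (hσ2 : σ ^ 2 * (1 - M.d * M.θmax) = 1) :
    D.sampleLaw M g n ≤ (σ ^ p).toNNReal ^ n • Measure.pi fun _ : Fin n =>
      (stdGaussian (EuclideanSpace ℝ (Fin p))).map (fun x => σ • x) := by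
  have hx := M.mul_θmax_lt_one
  have hlow := one_sub_mul_dotProduct_le (D.precision_symm M g) (D.precision_diag M g)
    (D.sum_abs_precision_le M hg)
  have hpos : (D.precision M g).PosDef := by
    refine Matrix.PosDef.of_dotProduct_mulVec_pos ?_ fun v hv => ?_
    · ext i j
      simp [D.precision_symm M g j i]
    · rw [star_trivial]
      refine lt_of_lt_of_le (mul_pos (by linarith) ?_) (hlow v)
      simpa using Matrix.dotProduct_star_self_pos_iff.2 hv
  have hle := multivariateGaussian_inv_le hpos (hpos.det_le_one_of_diag (D.precision_diag M g)) hσ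
    fun w => by
      calc w ⬝ᵥ w = σ ^ 2 * ((1 - M.d * M.θmax) * (w ⬝ᵥ w)) := by rw [← mul_assoc, hσ2, one_mul]
        _ ≤ _ := mul_le_mul_of_nonneg_left (hlow w) (by positivity)
  rw [Fintype.card_fin] at hle
  have : IsProbabilityMeasure ((stdGaussian (EuclideanSpace ℝ (Fin p))).map (fun x => σ • x)) :=
    Measure.isProbabilityMeasure_map (by fun_prop)
  have := Measure.pi_le_smul_pi (ι := Fin n)
    (μ := fun _ => multivariateGaussian 0 (D.precision M g)⁻¹)
    (ν := fun _ => (stdGaussian (EuclideanSpace ℝ (Fin p))).map (fun x => σ • x))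
    (σ ^ p).toNNReal fun _ => hle
  rwa [Fintype.card_fin] at this

/-- The events `ψ = G` are disjoint, and each has under its own model at most `σ ^ (p * n)` times
its probability under the common isotropic law. So the average of these probabilities, the chance
of success, is at most `σ ^ (p * n)` divided by the number of graphs. -/
theorem one_sub_errorProb_mul_card_le (M : ModelParams S) {δ ε : ℝ} {n : ℕ}
    {ψ : (Fin n → EuclideanSpace ℝ (Fin p)) → SimpleGraph (Fin p)}
    (hψ : ∀ G, MeasurableSet (ψ ⁻¹' {G})) (hne : (D.family M δ ε).Nonempty)
    {σ : ℝ} (hσ : 0 < σ) (hσ2 : σ ^ 2 * (1 - M.d * M.θmax) = 1) :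
    (1 - D.errorProb M δ ε n ψ) * (D.localGraphs M.d ε).card ≤ σ ^ (p * n) := by
  classical
  set Q := Measure.pi fun _ : Fin n =>
      (stdGaussian (EuclideanSpace ℝ (Fin p))).map (fun x => σ • x) with hQ
  have : IsProbabilityMeasure ((stdGaussian (EuclideanSpace ℝ (Fin p))).map (fun x => σ • x)) :=
    Measure.isProbabilityMeasure_map (by fun_prop)
  have : IsProbabilityMeasure Q := by rw [hQ]; infer_instance
  set labs := Finset.univ.filter fun lab => D.IsAdmissiblePartition M δ lab with hlabs
  have hfam : D.family M δ ε = labs ×ˢ D.localGraphs M.d ε := by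
    rw [family_eq_product]
  have hreg : ∀ g ∈ D.family M δ ε, open Classical in g.2.IsRegularOfDegree M.d := by
    intro g hg
    simp only [family, Finset.mem_filter, Finset.mem_univ, true_and] at hg
    exact hg.2.1
  have hcorrect : ∀ g ∈ D.family M δ ε,
      1 - (D.sampleLaw M g n).real {x | ψ x ≠ g.2} ≤ σ ^ (p * n) * Q.real (ψ ⁻¹' {g.2}) := by
    intro g hg
    have : IsProbabilityMeasure (D.sampleLaw M g n) := by rw [sampleLaw]; infer_instance
    have h1 : {x | ψ x ≠ g.2} = (ψ ⁻¹' {g.2})ᶜ := rfl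
    rw [h1, probReal_compl_eq_one_sub (hψ g.2), sub_sub_cancel]
    have h2 := Measure.le_iff'.1 (D.sampleLaw_le M (hreg g hg) n hσ hσ2) (ψ ⁻¹' {g.2})
    rw [Measure.smul_apply, ← hQ] at h2
    have h3 := ENNReal.toReal_mono (by
      rw [ENNReal.smul_def, smul_eq_mul]
      exact ENNReal.mul_ne_top ENNReal.coe_ne_top (measure_ne_top _ _)) h2
    refine h3.trans_eq ?_
    rw [ENNReal.smul_def, smul_eq_mul, ENNReal.toReal_mul, ENNReal.coe_toReal, NNReal.coe_pow,
      Real.coe_toNNReal _ (by positivity), ← pow_mul]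
    rfl
  have hdisj : ∑ G ∈ D.localGraphs M.d ε, Q.real (ψ ⁻¹' {G}) ≤ 1 := by
    rw [← measureReal_biUnion_finset]
    · exact measureReal_le_one
    · intro G _ G' _ hGG'
      exact Disjoint.preimage _ (by simpa using hGG')
    · exact fun G _ => hψ G
  have hsum : (D.family M δ ε).card * (1 - D.errorProb M δ ε n ψ) ≤
      labs.card * σ ^ (p * n) := by
    have hc : ((D.family M δ ε).card : ℝ) ≠ 0 := by
      exact_mod_cast (Finset.card_pos.2 hne).ne'
    rw [errorProb, mul_sub, mul_div_cancel₀ _ hc, mul_one]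
    calc _ = ∑ g ∈ D.family M δ ε, (1 - (D.sampleLaw M g n).real {x | ψ x ≠ g.2}) := by
          rw [Finset.sum_sub_distrib, Finset.sum_const, nsmul_eq_mul, mul_one]
      _ ≤ ∑ g ∈ D.family M δ ε, σ ^ (p * n) * Q.real (ψ ⁻¹' {g.2}) := Finset.sum_le_sum hcorrect
      _ = labs.card * (σ ^ (p * n) * ∑ G ∈ D.localGraphs M.d ε, Q.real (ψ ⁻¹' {G})) := by
          rw [hfam, Finset.sum_product]
          simp only [← Finset.mul_sum, Finset.sum_const, nsmul_eq_mul]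
          rw [mul_left_comm]
      _ ≤ labs.card * σ ^ (p * n) := by
          refine mul_le_mul_of_nonneg_left ?_ (by positivity)
          exact mul_le_of_le_one_right (by positivity) hdisj
  rw [hfam, Finset.card_product] at hsum
  push_cast at hsum
  have hl : (0 : ℝ) < labs.card := by
    rw [hfam] at hne
    exact_mod_cast Finset.card_pos.2 hne.fst
  refine le_of_mul_le_mul_left ?_ hl
  linarith

end Domain

/-! ### Asymptotics -/

namespace Domain

variable {p : ℕ} (D : Domain p)

/-- The expected number `η * r ^ 2` of vertices in a cell is at most of order `p` divided by the
number of cells, and at least of order `p ^ (2 * ξ)`. -/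
lemma cell_population_bounds {η γ ρ ξ : ℝ} (hη : 0 < η) (hρ : 0 < ρ) (hξ : 0 < ξ)
    (hγ : γ ≤ 1 / 2) (hr : D.r = ρ * D.area ^ ξ) (hdens : D.UniformDensity η γ) :
    D.cells.card * (η * D.r ^ 2) ≤ 2 * p ∧
      η * ρ ^ 2 * (2 / (3 * η)) ^ (2 * ξ) * (p : ℝ) ^ (2 * ξ) ≤ η * D.r ^ 2 := by
  have hN : 0 < η * D.r ^ 2 := by have := D.r_pos; positivity
  have hsum : |(p : ℝ) - D.cells.card * (η * D.r ^ 2)| ≤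
      D.cells.card * (1 / 2 * (η * D.r ^ 2)) := by
    have h1 : (p : ℝ) - D.cells.card * (η * D.r ^ 2) =
        ∑ c ∈ D.cells, (((D.verticesIn {c}).card : ℝ) - η * D.r ^ 2) := by
      rw [Finset.sum_sub_distrib, Finset.sum_const, nsmul_eq_mul]
      congr 1
      exact_mod_cast D.sum_card_verticesIn.symm
    rw [h1, ← nsmul_eq_mul]
    refine (Finset.abs_sum_le_sum_abs _ _).trans (Finset.sum_le_card_nsmul _ _ _ fun c hc => ?_)
    exact (hdens c hc).trans (mul_le_mul_of_nonneg_right hγ hN.le)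
  rw [abs_le] at hsum
  refine ⟨by linarith, ?_⟩
  have harea : (2 / (3 * η)) * p ≤ D.area := by
    rw [area, div_mul_eq_mul_div, div_le_iff₀ (by positivity)]
    nlinarith
  have h2 : ((2 / (3 * η)) * p) ^ (2 * ξ) ≤ D.area ^ (2 * ξ) :=
    Real.rpow_le_rpow (by positivity) harea (by positivity)
  rw [Real.mul_rpow (by positivity) (by positivity)] at h2
  have harea0 : 0 ≤ D.area := by rw [area]; positivity
  have h3 : (D.area ^ ξ) ^ 2 = D.area ^ (2 * ξ) := by
    rw [← Real.rpow_natCast, ← Real.rpow_mul harea0, mul_comm]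
    norm_num
  rw [hr, mul_pow, h3, mul_assoc, mul_assoc]
  refine mul_le_mul_of_nonneg_left (mul_le_mul_of_nonneg_left h2 (by positivity)) hη.le

end Domain

section Asymptotics

variable {S : ℕ} (M : ModelParams S) {p : ℕ → ℕ} {D : ∀ m, Domain (p m)}

/-- Almost all of the `d * p / 2` edges can be switched, two at a time, and each switching has
at least of order `p ^ (2 * ξ)` outcomes. -/
lemma eventually_pow_le_card_localGraphs
    (hp : Tendsto p atTop atTop) (hr : ∀ m, (D m).r = M.ρ * (D m).area ^ M.ξ)
    {γ ε : ℕ → ℝ} (hγ : Tendsto γ atTop (𝓝 0)) (hε : Tendsto ε atTop (𝓝 0))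
    (hdens : ∀ m, (D m).UniformDensity M.η (γ m))
    (hne : ∀ m, ((D m).localGraphs M.d (ε m)).Nonempty) {τ : ℝ} (hτ : 0 < τ) (hτ1 : τ < 1) :
    ∃ c : ℝ, 0 < c ∧ ∀ᶠ m in atTop,
      (c * (p m : ℝ) ^ (2 * M.ξ)) ^ ⌊(1 - τ) * (M.d * p m) / 4⌋₊ ≤
        ((D m).localGraphs M.d (ε m)).card := by
  have hη := M.η_pos
  have hρ := M.ρ_pos
  have hξ := M.ξ_pos
  have hd : (1 : ℝ) ≤ M.d := by exact_mod_cast M.d_pos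
  set c₀ : ℝ := M.η * M.ρ ^ 2 * (2 / (3 * M.η)) ^ (2 * M.ξ) with hc₀
  have hc₀pos : 0 < c₀ := by positivity
  refine ⟨τ / 8 * c₀ / (M.d * M.d), by positivity, ?_⟩
  have hpR : Tendsto (fun m => (p m : ℝ)) atTop atTop := tendsto_natCast_atTop_atTop.comp hp
  have hpow : Tendsto (fun m => (p m : ℝ) ^ (2 * M.ξ)) atTop atTop :=
    (tendsto_rpow_atTop (by positivity)).comp hpR
  have hbig : ∀ᶠ m in atTop, 1 + 2 * (M.d * (M.d + 1) : ℝ) ≤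
      τ / 8 * c₀ * (p m : ℝ) ^ (2 * M.ξ) :=
    (hpow.const_mul_atTop (by positivity)).eventually_ge_atTop _
  have hεs : ∀ᶠ m in atTop, |ε m| < τ / 2 := by
    have := hε.abs
    rw [abs_zero] at this
    exact this.eventually_lt_const (by positivity)
  filter_upwards [hbig, hεs, hγ.eventually_lt_const (show (0 : ℝ) < 1 / 2 by norm_num)]
    with m h1 h2 h3
  obtain ⟨h4, h5⟩ := (D m).cell_population_bounds hη hρ hξ h3.le (hr m) (hdens m)
  rw [← hc₀] at h5
  set P : ℝ := (p m : ℝ) ^ (2 * M.ξ) with hP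
  set N : ℝ := M.η * (D m).r ^ 2 with hN
  set k : ℕ := 2 * (M.d * (M.d + 1)) with hk
  have hk' : (k : ℝ) = 2 * (M.d * (M.d + 1)) := by rw [hk]; push_cast; ring
  have h6 : τ / 8 * c₀ * P ≤ τ / 8 * N := by
    rw [mul_assoc]; exact mul_le_mul_of_nonneg_left h5 (by positivity)
  -- A cell is used as long as it holds more than `L + k` darts to switch, where `L + k ≤ τ / 4 * N`.
  -- So at most `τ / 2 * p` darts are left over inside cells, and `τ / 2 * d * p` run between cells.
  have hkN : k ≤ ⌊τ / 4 * N⌋₊ := by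
    apply Nat.le_floor
    rw [hk']
    nlinarith
  set L : ℕ := ⌊τ / 4 * N⌋₊ - k with hL
  have hLk : ((L : ℝ) + k) = ⌊τ / 4 * N⌋₊ := by
    rw [hL, Nat.cast_sub hkN]; ring
  have hLup : (L : ℝ) + k ≤ τ / 4 * N := by
    rw [hLk]
    exact Nat.floor_le (by nlinarith)
  have hLlow : τ / 8 * c₀ * P ≤ L := by
    have := Nat.lt_floor_add_one (τ / 4 * N)
    linarith
  have hp0 : (0 : ℝ) ≤ p m := Nat.cast_nonneg _
  have hdp : (p m : ℝ) ≤ M.d * p m := le_mul_of_one_le_left hp0 hd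
  set T : ℕ := ⌊(1 - τ) * (M.d * p m) / 4⌋₊ with hT
  have hTle : (T : ℝ) ≤ (1 - τ) * (M.d * p m) / 4 := Nat.floor_le (by
    have : 0 ≤ 1 - τ := by linarith
    positivity)
  have hcount := (D m).pow_le_card_localGraphs (hne m) (L := L) (T := T) (by
    rw [← hk']
    have h7 : ((D m).cells.card : ℝ) * (L + k) ≤ (D m).cells.card * (τ / 4 * N) :=
      mul_le_mul_of_nonneg_left hLup (by positivity)
    have h8 : |ε m| * (M.d * p m) ≤ τ / 2 * (M.d * p m) :=
      mul_le_mul_of_nonneg_right h2.le (by positivity)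
    nlinarith)
  have hcount' : (L : ℝ) ^ T ≤ (M.d * M.d) ^ T * ((D m).localGraphs M.d (ε m)).card := by
    exact_mod_cast hcount
  calc (τ / 8 * c₀ / (M.d * M.d) * P) ^ T = (τ / 8 * c₀ * P) ^ T / (M.d * M.d : ℝ) ^ T := by
        rw [← div_pow]; congr 1; ring
    _ ≤ (L : ℝ) ^ T / (M.d * M.d : ℝ) ^ T := by gcongr
    _ ≤ _ := by
        rw [div_le_iff₀ (by positivity), mul_comm]
        exact hcount'

/-- The sharper asymptotic bound `n ≥ (1 - o(1)) * d * ξ * log p / log (1 / (1 - d * θmax))`. -/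
theorem eventually_mul_log_le
    (hp : Tendsto p atTop atTop) (hr : ∀ m, (D m).r = M.ρ * (D m).area ^ M.ξ)
    {γ δ ε : ℕ → ℝ} (hγ : Tendsto γ atTop (𝓝 0)) (hε : Tendsto ε atTop (𝓝 0))
    (hdens : ∀ m, (D m).UniformDensity M.η (γ m))
    (hne : ∀ m, ((D m).family M (δ m) (ε m)).Nonempty) {n : ℕ → ℕ}
    {ψ : ∀ m, (Fin (n m) → EuclideanSpace ℝ (Fin (p m))) → SimpleGraph (Fin (p m))}
    (hψ : ∀ m G, MeasurableSet (ψ m ⁻¹' {G}))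
    (herr : Tendsto (fun m => (D m).errorProb M (δ m) (ε m) (n m) (ψ m)) atTop (𝓝 0))
    {τ : ℝ} (hτ : 0 < τ) (hτ1 : τ < 1) :
    ∀ᶠ m in atTop, (1 - τ) * (M.d * M.ξ * Real.log (p m)) ≤
      n m * -Real.log (1 - M.d * M.θmax) := by
  have hx := M.mul_θmax_lt_one
  have hξ := M.ξ_pos
  have hd : (1 : ℝ) ≤ M.d := by exact_mod_cast M.d_pos
  have hne' : ∀ m, ((D m).localGraphs M.d (ε m)).Nonempty := by
    intro m
    have := hne m
    rw [Domain.family_eq_product] at this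
    exact this.snd
  obtain ⟨c, hc, hcount⟩ := eventually_pow_le_card_localGraphs M hp hr hγ hε hdens hne'
    (half_pos hτ) (by linarith)
  have hpR : Tendsto (fun m => (p m : ℝ)) atTop atTop := tendsto_natCast_atTop_atTop.comp hp
  have hlog : Tendsto (fun m => Real.log (p m)) atTop atTop := Real.tendsto_log_atTop.comp hpR
  -- Half of the loss `τ` is due to edges that are not switched, a quarter to rounding the number of
  -- switchings, and a quarter to the constant factors.
  have hl1 : ∀ᶠ m in atTop, |Real.log c| ≤ 2 * M.ξ * Real.log (p m) :=
    (hlog.const_mul_atTop (by positivity)).eventually_ge_atTop _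
  have hl2 : ∀ᶠ m in atTop, |Real.log c| * M.d / 2 + 2 * Real.log 2 ≤
      τ / 4 * (M.d * M.ξ) * Real.log (p m) :=
    (hlog.const_mul_atTop (by positivity)).eventually_ge_atTop _
  have hl3 : ∀ᶠ m in atTop, 4 / (τ / 4) ≤ (p m : ℝ) := hpR.eventually_ge_atTop _
  filter_upwards [hcount, hl1, hl2, hl3, hpR.eventually_ge_atTop 1,
    herr.eventually_lt_const (show (0 : ℝ) < 1 / 2 by norm_num)] with m h1 h2 h3 h4 h5 h6
  set l := Real.log (p m) with hl
  set a := -Real.log (1 - M.d * M.θmax) with ha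
  set F := ((D m).localGraphs M.d (ε m)).card with hF
  have hFpos : (0 : ℝ) < F := by exact_mod_cast Finset.card_pos.2 (hne' m)
  have hp0 : (0 : ℝ) < p m := by linarith
  -- the scale of the isotropic law is `(1 - d * θmax) ^ (-1 / 2)`
  have hup : Real.log F ≤ Real.log 2 + p m * n m * (a / 2) := by
    have hσ : 0 < Real.exp (a / 2) := Real.exp_pos _
    have h7 := (D m).one_sub_errorProb_mul_card_le M (hψ m) (hne m) hσ (by
      rw [← Real.exp_nat_mul, ha]
      have : ((2 : ℕ) : ℝ) * (-Real.log (1 - M.d * M.θmax) / 2) =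
        -Real.log (1 - M.d * M.θmax) := by push_cast; ring
      rw [this, Real.exp_neg, Real.exp_log (by linarith), inv_mul_cancel₀ (by linarith)])
    rw [← Real.exp_nat_mul] at h7
    have h8 : (F : ℝ) ≤ 2 * Real.exp ((p m * n m : ℕ) * (a / 2)) := by nlinarith
    have h9 := Real.log_le_log hFpos h8
    rw [Real.log_mul two_ne_zero (Real.exp_pos _).ne', Real.log_exp] at h9
    push_cast at h9
    exact h9
  set T : ℕ := ⌊(1 - τ / 2) * (M.d * p m) / 4⌋₊ with hT
  have hlow : T * (2 * M.ξ * l + Real.log c) ≤ Real.log F := by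
    have h7 := Real.log_le_log (by positivity) h1
    rw [Real.log_pow, Real.log_mul hc.ne' (by positivity), Real.log_rpow hp0] at h7
    linarith
  have hTlow : (1 - τ / 2) * (M.d * p m) / 4 - 1 ≤ T := by
    have := Nat.lt_floor_add_one ((1 - τ / 2) * (M.d * p m) / 4)
    linarith
  have hTlow' : (1 - 3 * τ / 4) * (M.d * p m) / 4 ≤ T := by
    have h7 : 4 ≤ p m * (τ / 4) := by
      rwa [div_le_iff₀ (by positivity)] at h4
    nlinarith
  have hc1 := neg_abs_le (Real.log c)
  have h10 : (1 - 3 * τ / 4) * (M.d * p m) / 4 * (2 * M.ξ * l - |Real.log c|) ≤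
      Real.log 2 + p m * n m * (a / 2) := by
    refine le_trans ?_ (hlow.trans hup)
    refine (mul_le_mul_of_nonneg_right hTlow' (by linarith)).trans ?_
    exact mul_le_mul_of_nonneg_left (by linarith) (Nat.cast_nonneg _)
  have h11 : (1 - 3 * τ / 4) * M.d / 2 * (2 * M.ξ * l - |Real.log c|) ≤
      2 * Real.log 2 + n m * a := by
    have h12 : 0 < Real.log 2 := Real.log_pos (by norm_num)
    have h13 : Real.log 2 ≤ p m * Real.log 2 := le_mul_of_one_le_left h12.le h5
    refine le_of_mul_le_mul_left ?_ (half_pos hp0)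
    nlinarith
  have h14 : 0 ≤ τ * M.d * |Real.log c| := by positivity
  nlinarith

end Asymptotics

end

/-! ### The sample size -/

theorem theorem1 {S : ℕ} (M : ModelParams S)
    -- a sequence of domains filled with `p m → ∞` vertices
    (p : ℕ → ℕ) (hp : Tendsto p atTop atTop) (D : ∀ m, Domain (p m))
    (hr : ∀ m, (D m).r = M.ρ * (D m).area ^ M.ξ)
    -- vanishing tolerances
    (γ δ ε : ℕ → ℝ) (hγ : Tendsto γ atTop (𝓝 0)) (hδ : Tendsto δ atTop (𝓝 0))
    (hε : Tendsto ε atTop (𝓝 0))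
    (hdens : ∀ m, (D m).UniformDensity M.η (γ m))
    (hne : ∀ m, ((D m).family M (δ m) (ε m)).Nonempty)
    -- sample sizes and graph selection procedures
    (n : ℕ → ℕ)
    (ψ : ∀ m, (Fin (n m) → EuclideanSpace ℝ (Fin (p m))) → SimpleGraph (Fin (p m)))
    (hψ : ∀ m G, MeasurableSet (ψ m ⁻¹' {G}))
    (herr : Tendsto (fun m => (D m).errorProb M (δ m) (ε m) (n m) (ψ m)) atTop (𝓝 0)) :
    (∀ᶠ m in atTop,
      M.d * Real.log ((p m : ℝ) ^ M.ξ / M.d) /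
        Real.log ((2 * Real.pi * Real.exp 1) ^ 2 / (1 - M.d * M.θmax)) ≤ n m) ∧
    (fun m => Real.log (p m)) =O[atTop] (fun m => (n m : ℝ)) := by
  have hx := M.mul_θmax_lt_one
  have hx0 : 0 < M.d * M.θmax := mul_pos (by exact_mod_cast M.d_pos) M.θmax_pos
  have hd : (1 : ℝ) ≤ M.d := by exact_mod_cast M.d_pos
  have hξ := M.ξ_pos
  have ha : 0 < -Real.log (1 - M.d * M.θmax) :=
    neg_pos.2 (Real.log_neg (by linarith) (by linarith))
  have h2 : 1 < (2 * Real.pi * Real.exp 1) ^ 2 := by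
    have h3 := Real.pi_gt_three
    have h4 := Real.add_one_le_exp (1 : ℝ)
    have h5 : 1 < 2 * Real.pi * Real.exp 1 := by nlinarith
    exact one_lt_pow₀ h5 two_ne_zero
  have hab : -Real.log (1 - M.d * M.θmax) <
      Real.log ((2 * Real.pi * Real.exp 1) ^ 2 / (1 - M.d * M.θmax)) := by
    rw [Real.log_div (by positivity) (by linarith)]
    linarith [Real.log_pos h2]
  set a := -Real.log (1 - M.d * M.θmax)
  set b := Real.log ((2 * Real.pi * Real.exp 1) ^ 2 / (1 - M.d * M.θmax))
  have hb : 0 < b := ha.trans hab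
  have hmain := fun {τ : ℝ} => eventually_mul_log_le M hp hr hγ hε hdens hne hψ herr (τ := τ)
  have hp1 : ∀ᶠ m in atTop, 1 ≤ p m := hp.eventually_ge_atTop 1
  constructor
  · -- with this choice of `τ` the sharper bound turns into `d * ξ * log p ≤ n * b`
    have hab' : a / b < 1 := (div_lt_one hb).2 hab
    filter_upwards [hmain (τ := 1 - a / b) (by linarith) (by linarith [div_pos ha hb]), hp1]
      with m h3 h4
    have hp0 : (0 : ℝ) < p m := by exact_mod_cast h4
    rw [sub_sub_cancel, div_mul_eq_mul_div, div_le_iff₀ hb] at h3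
    rw [div_le_iff₀ hb, Real.log_div (by positivity) (by positivity), Real.log_rpow hp0]
    have h5 : M.d * M.ξ * Real.log (p m) ≤ n m * b := by
      refine le_of_mul_le_mul_left ?_ ha
      linarith
    have h6 := mul_nonneg (zero_le_one.trans hd) (Real.log_nonneg hd)
    linarith
  · refine Asymptotics.IsBigO.of_bound (2 * a / (M.d * M.ξ)) ?_
    filter_upwards [hmain (τ := 1 / 2) (by norm_num) (by norm_num), hp1] with m h3 h4
    rw [Real.norm_of_nonneg (Real.log_nonneg (by exact_mod_cast h4)),
      Real.norm_of_nonneg (Nat.cast_nonneg _), div_mul_eq_mul_div, le_div_iff₀ (by positivity)]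
    linarith
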